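/- Let $\mathbb{D}=\{z\in\mathbb{C}:|z|<1\}$, and for real $a,b,\mu,\nu\ge 1$ let $$\mathbb{W}_{(\mu,a),(\nu,b)}(z)=z\,\Gamma(a)\Gamma(b)\sum_{k=0}^{\infty}\frac{z^{k}}{\Gamma(a+k\mu)\,\Gamma(b+k\nu)}$$ be the normalized four parameters Wright function. Let $\mathcal{A}$ be the class of functions $f$ analytic in $\mathbb{D}$ with $f(0)=0$ and $f'(0)=1$. Let $UCV$ be the class of uniformly convex functions, that is, of all $f\in\mathcal{A}$ such that for every circular arc $\gamma\subset\mathbb{D}$ (complete circles included) whose center also lies in $\mathbb{D}$, the image arc $f(\gamma)$ is convex, meaning that it has a nonvanishing tangent vector whose argument can be chosen as a continuous nondecreasing function as $\gamma$ is traversed in the positive direction. Let $\mathcal{S}_p$ be the class of all functions $f$ on $\mathbb{D}$ of the form $f(z)=zF'(z)$ with $F\in UCV$. Theorem. Let $a,b,\mu,\nu\ge 1$ be real numbers such that $b\ge\tau(a)$, where $$\tau(a)=\frac{3(a+1)-a^2+\sqrt{a^4+14a^3+35a^2+30a+9}}{2a(a+1)}.$$ Then $\mathbb{W}_{(\mu,a),(\nu,b)}\in\mathcal{S}_p$.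 -/

import Mathlib

noncomputable section

/-- The four parameter Wright function
`𝒲_{(μ,a),(ν,b)}(z) = ∑_{k ≥ 0} z ^ k / (Γ(a + k μ) Γ(b + k ν))` with real parameters. -/
def fourParamWright (μ a ν b : ℝ) (z : ℂ) : ℂ :=
  ∑' k : ℕ, z ^ k / ((Real.Gamma (a + k * μ) * Real.Gamma (b + k * ν) : ℝ) : ℂ)

/-- The normalized function `𝕎_{(μ,a),(ν,b)}(z) = z Γ(a) Γ(b) 𝒲_{(μ,a),(ν,b)}(z)`. -/
def normWright (μ a ν b : ℝ) (z : ℂ) : ℂ :=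
  z * (Real.Gamma a : ℂ) * (Real.Gamma b : ℂ) * fourParamWright μ a ν b z

/-- The series that defines `fourParamWright` converges absolutely in the range of parameters
under consideration, so that its `∑'` is the genuine sum. -/
theorem summable_fourParamWright {μ a ν b : ℝ} (hμ : 1 ≤ μ) (ha : 1 ≤ a) (hν : 1 ≤ ν)
    (hb : 1 ≤ b) (z : ℂ) :
    Summable fun k : ℕ =>
      z ^ k / ((Real.Gamma (a + k * μ) * Real.Gamma (b + k * ν) : ℝ) : ℂ) := by
  have key : ∀ (x m : ℝ), 1 ≤ x → 1 ≤ m → ∀ k : ℕ,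
      ((k + 1).factorial : ℝ) ≤ Real.Gamma (x + ((k + 1 : ℕ) : ℝ) * m) := by
    intro x m hx hm k
    rw [← Real.Gamma_nat_eq_factorial]
    have hk : (0 : ℝ) ≤ k := Nat.cast_nonneg k
    apply Real.Gamma_strictMonoOn_Ici.monotoneOn
    · simp only [Set.mem_Ici]; push_cast; linarith
    · simp only [Set.mem_Ici]; push_cast; nlinarith
    · push_cast; nlinarith
  rw [← summable_nat_add_iff 1]
  refine Summable.of_norm_bounded
    ((summable_nat_add_iff 1).mpr (Real.summable_pow_div_factorial ‖z‖)) ?_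
  intro k
  have h1 := key a μ ha hμ k
  have h2 := key b ν hb hν k
  have hf : (1 : ℝ) ≤ ((k + 1).factorial : ℝ) := by
    exact_mod_cast Nat.succ_le_of_lt (Nat.factorial_pos _)
  have h3 : ((k + 1).factorial : ℝ) ≤
      Real.Gamma (a + ((k + 1 : ℕ) : ℝ) * μ) * Real.Gamma (b + ((k + 1 : ℕ) : ℝ) * ν) := by
    nlinarith
  rw [norm_div, norm_pow, Complex.norm_real, Real.norm_eq_abs, abs_of_nonneg (by linarith)]
  gcongr

/-- The class `𝒜`: functions that are analytic in the open unit disk `𝔻`, normalized by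
`f 0 = 0` and `f' 0 = 1`. Only the values on `𝔻` matter. -/
def classA : Set (ℂ → ℂ) :=
  {f | DifferentiableOn ℂ f (Metric.ball 0 1) ∧ f 0 = 0 ∧ deriv f 0 = 1}

/-- A regular arc `w : [α, β] → ℂ` is convex if the argument of its tangent vector is
nondecreasing: at every time the velocity is a positive multiple of `exp (i θ(t))`, where the
angle `θ` is a continuous nondecreasing function on `[α, β]`. -/
def IsConvexArc (w : ℝ → ℂ) (α β : ℝ) : Prop :=
  ∃ θ : ℝ → ℝ, ContinuousOn θ (Set.Icc α β) ∧ MonotoneOn θ (Set.Icc α β) ∧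
    ∀ t ∈ Set.Icc α β, ∃ ρ : ℝ, 0 < ρ ∧
      HasDerivWithinAt w (ρ * Complex.exp (θ t * Complex.I)) (Set.Icc α β) t

/-- The class `UCV` of uniformly convex functions: `f ∈ 𝒜` such that, for every circular arc
`γ = {ζ + r e^{it} : α ≤ t ≤ β}` contained in `𝔻` whose center `ζ` is also in `𝔻`,
the image arc `f(γ)` is convex. Complete circles (`β = α + 2π`) are included. -/
def classUCV : Set (ℂ → ℂ) :=
  {f | f ∈ classA ∧
    ∀ ζ ∈ Metric.ball (0 : ℂ) 1, ∀ r α β : ℝ, 0 < r → α < β → β ≤ α + 2 * Real.pi →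
      (∀ t ∈ Set.Icc α β, circleMap ζ r t ∈ Metric.ball (0 : ℂ) 1) →
      IsConvexArc (fun t => f (circleMap ζ r t)) α β}

/-- Rønning's class `𝒮_p = {f : f(z) = z F'(z) on 𝔻 for some F ∈ UCV}`. -/
def classSp : Set (ℂ → ℂ) :=
  {f | ∃ F ∈ classUCV, ∀ z ∈ Metric.ball (0 : ℂ) 1, f z = z * deriv F z}

/-- The bound `τ(a)`. -/
def tauBound (a : ℝ) : ℝ :=
  (3 * (a + 1) - a ^ 2 + Real.sqrt (a ^ 4 + 14 * a ^ 3 + 35 * a ^ 2 + 30 * a + 9)) /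
    (2 * a * (a + 1))

end

/-! Write the normalized function as `z * g z` with `g z = ∑ c_k z ^ k`, `c_k ≥ 0`, `c_0 = 1`, and
let `F` be the primitive of `g` with `F 0 = 0`; the claim is that `F` is uniformly convex. On a
circle centred at `ζ` the tangent angle of `F` turns at rate `1 + Im (i (z - ζ) g' / g)`. Since `|z
- ζ| < 2` in the disk, `2 |g'| ≤ |g|` makes this nonnegative. Bounding both sides coefficientwise
reduces everything to `∑ (2k + 1) c_k ≤ 2`. Monotonicity of `Γ` on `[2, ∞)` reduces this to `μ = ν =
1`, with coefficients `d_{k+1} = d_k / ((a + k)(b + k))`. A geometric tail from `k = 3` leaves `3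
d_1 + 5 d_2 + 8 d_3 ≤ 1`, which follows from `τ(a) ≤ b`. -/

open Complex Metric in
/-- If `g = F'` has positive real part on the unit disk and `2 |g'| ≤ |g|`, then `F` is
uniformly convex. -/
theorem mem_classUCV_of_deriv_bound {F g g' : ℂ → ℂ}
    (hF : ∀ z ∈ ball (0 : ℂ) 1, HasDerivAt F (g z) z)
    (hg : ∀ z ∈ ball (0 : ℂ) 1, HasDerivAt g (g' z) z)
    (hF0 : F 0 = 0) (hg0 : g 0 = 1) (hre : ∀ z ∈ ball (0 : ℂ) 1, 0 < (g z).re)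
    (hbound : ∀ z ∈ ball (0 : ℂ) 1, 2 * ‖g' z‖ ≤ ‖g z‖) : F ∈ classUCV := by
  have h0 : (0 : ℂ) ∈ ball (0 : ℂ) 1 := mem_ball_self one_pos
  refine ⟨⟨fun z hz => (hF z hz).differentiableAt.differentiableWithinAt, hF0, ?_⟩, ?_⟩
  · rw [(hF 0 h0).deriv, hg0]
  intro ζ hζ r α β hr hαβ hβ hmem
  -- The velocity is `i r e^{it} g`, hence the angle `t + π/2 + arg g`. As `Re g > 0`, the principal
  -- logarithm is differentiable along `g`.
  have hθ : ∀ t ∈ Set.Icc α β, HasDerivAt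
      (fun t : ℝ => t + Real.pi / 2 + (Complex.log (g (circleMap ζ r t))).im)
      (1 + (circleMap 0 r t * I * g' (circleMap ζ r t) / g (circleMap ζ r t)).im) t := by
    intro t ht
    have h1 := (hg _ (hmem t ht)).comp t (hasDerivAt_circleMap ζ r t)
    have h2 := h1.clog_real (Or.inl (hre _ (hmem t ht)))
    have h3 := (Complex.imCLM.hasFDerivAt.comp_hasDerivAt t h2)
    have h4 := ((hasDerivAt_id t).add_const (Real.pi / 2)).add h3
    refine h4.congr_deriv ?_
    rw [Complex.imCLM_apply, mul_comm (g' _), Function.comp_apply]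
  refine ⟨fun t => t + Real.pi / 2 + (Complex.log (g (circleMap ζ r t))).im,
    fun t ht => (hθ t ht).continuousAt.continuousWithinAt, ?_, ?_⟩
  · refine monotoneOn_of_deriv_nonneg (convex_Icc α β)
      (fun t ht => (hθ t ht).continuousAt.continuousWithinAt)
      (fun t ht => (hθ t (interior_subset ht)).differentiableAt.differentiableWithinAt) ?_
    intro t ht
    have ht' := interior_subset ht
    rw [(hθ t ht').deriv]
    set z := circleMap ζ r t with hz
    have hzb := hmem t ht'
    have hgpos : 0 < ‖g z‖ := norm_pos_iff.2 fun h => by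
      have := hre z hzb
      simp [h] at this
    have hr2 : ‖circleMap 0 r t‖ ≤ 2 := by
      have e : circleMap 0 r t = z - ζ := by simp [hz, circleMap]
      rw [e]
      refine (norm_sub_le _ _).trans ?_
      have h1 := mem_ball_zero_iff.1 hzb
      have h2 := mem_ball_zero_iff.1 hζ
      linarith
    have hle : ‖circleMap 0 r t * I * g' z / g z‖ ≤ 1 := by
      rw [norm_div, norm_mul, norm_mul, Complex.norm_I, mul_one, div_le_one hgpos]
      refine le_trans ?_ (hbound z hzb)
      gcongr
    have := (abs_le.1 ((Complex.abs_im_le_norm _).trans hle)).1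
    linarith
  · intro t ht
    have hzb := hmem t ht
    have hgne : g (circleMap ζ r t) ≠ 0 := fun h => by
      have := hre _ hzb
      simp [h] at this
    refine ⟨r * ‖g (circleMap ζ r t)‖, mul_pos hr (norm_pos_iff.2 hgne), ?_⟩
    have h1 := ((hF _ hzb).comp t (hasDerivAt_circleMap ζ r t)).hasDerivWithinAt
      (s := Set.Icc α β)
    refine h1.congr_deriv (Eq.symm ?_)
    simp only [Complex.log_im]
    push_cast
    rw [add_mul, add_mul, Complex.exp_add, Complex.exp_add, Complex.exp_pi_div_two_mul_I]
    nth_rewrite 3 [← Complex.norm_mul_exp_arg_mul_I (g (circleMap ζ r t))]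
    simp only [circleMap, zero_add]
    ring

open Metric in
/-- A coefficient condition for `z ∑ c_k z^k` to belong to `𝒮_p`. -/
theorem mul_tsum_mem_classSp {c : ℕ → ℝ} (hc : ∀ k, 0 ≤ c k) (hc0 : c 0 = 1)
    (hs : Summable fun k : ℕ => (2 * (k : ℝ) + 1) * c k)
    (hle : ∑' k : ℕ, (2 * (k : ℝ) + 1) * c k ≤ 2) :
    (fun z : ℂ => z * ∑' k : ℕ, (c k : ℂ) * z ^ k) ∈ classSp := by
  have hsc : Summable c := by
    refine Summable.of_nonneg_of_le hc (fun k => ?_) hs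
    nlinarith [hc k, mul_nonneg (Nat.cast_nonneg (α := ℝ) k) (hc k)]
  have hsk : Summable fun k : ℕ => (k : ℝ) * c k := by
    refine Summable.of_nonneg_of_le (fun k => mul_nonneg (Nat.cast_nonneg k) (hc k))
      (fun k => ?_) hs
    nlinarith [hc k, mul_nonneg (Nat.cast_nonneg (α := ℝ) k) (hc k)]
  have hsum : 2 * ∑' k : ℕ, (k : ℝ) * c k + ∑' k, c k ≤ 2 := by
    rw [← tsum_mul_left, ← (hsk.mul_left 2).tsum_add hsc]
    refine le_of_eq_of_le (tsum_congr fun k => ?_) hle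
    ring
  have hpow : ∀ (z : ℂ), z ∈ ball (0 : ℂ) 1 → ∀ k : ℕ, ‖z‖ ^ k ≤ 1 := fun z hz k =>
    pow_le_one₀ (norm_nonneg _) (mem_ball_zero_iff.1 hz).le
  have hnc : ∀ (z : ℂ), z ∈ ball (0 : ℂ) 1 → ∀ k : ℕ, ‖(c k : ℂ) * z ^ k‖ ≤ c k := by
    intro z hz k
    rw [norm_mul, norm_pow, Complex.norm_real, Real.norm_of_nonneg (hc k)]
    exact mul_le_of_le_one_right (hc k) (hpow z hz k)
  have hnk : ∀ (z : ℂ), z ∈ ball (0 : ℂ) 1 → ∀ k : ℕ,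
      ‖(c k : ℂ) * (k * z ^ (k - 1))‖ ≤ k * c k := by
    intro z hz k
    rw [norm_mul, norm_mul, norm_pow, Complex.norm_real, Real.norm_of_nonneg (hc k),
      Complex.norm_natCast, mul_comm (k : ℝ) (c k)]
    exact mul_le_mul_of_nonneg_left
      (mul_le_of_le_one_right (Nat.cast_nonneg k) (hpow z hz _)) (hc k)
  have h0 : (0 : ℂ) ∈ ball (0 : ℂ) 1 := mem_ball_self one_pos
  have hpre : IsPreconnected (ball (0 : ℂ) 1) := (convex_ball 0 1).isPreconnected
  have hF : ∀ z ∈ ball (0 : ℂ) 1, HasDerivAt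
      (fun z : ℂ => ∑' k : ℕ, (c k : ℂ) * (z ^ (k + 1) / ((k + 1 : ℕ) : ℂ)))
      (∑' k : ℕ, (c k : ℂ) * z ^ k) z := by
    intro z hz
    refine hasDerivAt_tsum_of_isPreconnected hsc isOpen_ball hpre
      (fun k y _ => ?_) (fun k y hy => hnc y hy k) h0 (by simp [summable_zero]) hz
    have hk : ((k + 1 : ℕ) : ℂ) ≠ 0 := Nat.cast_ne_zero.2 k.succ_ne_zero
    have h := ((hasDerivAt_pow (k + 1) y).div_const ((k + 1 : ℕ) : ℂ)).const_mul (c k : ℂ)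
    rwa [Nat.add_sub_cancel, mul_div_cancel_left₀ _ hk] at h
  have hg : ∀ z ∈ ball (0 : ℂ) 1, HasDerivAt (fun z : ℂ => ∑' k : ℕ, (c k : ℂ) * z ^ k)
      (∑' k : ℕ, (c k : ℂ) * (k * z ^ (k - 1))) z := by
    intro z hz
    exact hasDerivAt_tsum_of_isPreconnected hsk isOpen_ball hpre
      (fun k y _ => (hasDerivAt_pow k y).const_mul _) (fun k y hy => hnk y hy k) h0
      (Summable.of_norm_bounded hsc (hnc 0 h0)) hz
  have hg1 : ∀ z ∈ ball (0 : ℂ) 1, ‖(∑' k : ℕ, (c k : ℂ) * z ^ k) - 1‖ ≤ ∑' k, c k - 1 := by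
    intro z hz
    have hsz : Summable fun k : ℕ => (c k : ℂ) * z ^ k :=
      Summable.of_norm_bounded hsc (hnc z hz)
    rw [hsz.tsum_eq_zero_add, hsc.tsum_eq_zero_add, hc0]
    simp only [pow_zero, Complex.ofReal_one, mul_one, add_sub_cancel_left]
    exact tsum_of_norm_bounded ((summable_nat_add_iff 1).2 hsc).hasSum fun k => hnc z hz (k + 1)
  -- With `hsum` this gives `∑ c_k - 1 ≤ 1/3`, so `Re g ≥ 2/3`.
  have hmono : ∑' k, c k - 1 ≤ ∑' k : ℕ, (k : ℝ) * c k := by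
    rw [hsc.tsum_eq_zero_add, hsk.tsum_eq_zero_add, hc0]
    simp only [Nat.cast_zero, zero_mul, zero_add, add_sub_cancel_left]
    refine ((summable_nat_add_iff 1).2 hsc).tsum_le_tsum (fun k => ?_)
      ((summable_nat_add_iff 1).2 hsk)
    refine le_mul_of_one_le_left (hc _) ?_
    push_cast
    linarith [Nat.cast_nonneg (α := ℝ) k]
  refine ⟨_, mem_classUCV_of_deriv_bound hF hg (by simp) ?_ ?_ ?_, ?_⟩
  · rw [tsum_eq_single 0 (fun k hk => by simp [hk])]
    simp [hc0]
  · intro z hz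
    have h1 := (abs_le.1 ((Complex.abs_re_le_norm _).trans (hg1 z hz))).1
    rw [Complex.sub_re, Complex.one_re] at h1
    linarith
  · intro z hz
    have h1 : ‖∑' k : ℕ, (c k : ℂ) * (k * z ^ (k - 1))‖ ≤ ∑' k : ℕ, (k : ℝ) * c k :=
      tsum_of_norm_bounded hsk.hasSum (hnk z hz)
    have h2 := hg1 z hz
    -- `|g| ≥ 1 - |g - 1| ≥ 2 - ∑ c_k ≥ 2 ∑ k c_k ≥ 2 |g'|`.
    have h3 := norm_sub_norm_le (1 : ℂ) (1 - ∑' k : ℕ, (c k : ℂ) * z ^ k)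
    rw [sub_sub_cancel, norm_one, norm_sub_rev] at h3
    linarith
  · intro z hz
    rw [(hF z hz).deriv]

/-- `τ(a)` is the larger root of `a(a+1) b² + (a² - 3(a+1)) b - (5a+3)`, the difference of the two
sides; squaring out the root completes the square. -/
theorem quadratic_nonneg_of_tauBound_le {a b : ℝ} (ha : 1 ≤ a) (h : tauBound a ≤ b) :
    3 * ((a + 1) * (b + 1)) + 2 * a ≤ a * b * ((a + 1) * (b + 1) - 1) := by
  have hpos : 0 < 2 * a * (a + 1) := by positivity
  rw [tauBound, div_le_iff₀ hpos] at h
  have h2 := (Real.sqrt_le_iff.1 (le_sub_iff_add_le'.2 h)).2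
  have h3 : 0 ≤ 4 * (a * (a + 1)) *
      (a * b * ((a + 1) * (b + 1) - 1) - (3 * ((a + 1) * (b + 1)) + 2 * a)) := by
    linear_combination h2
  exact sub_nonneg.1 (nonneg_of_mul_nonneg_right h3 (by positivity))

theorem three_terms_le_one {a b : ℝ} (ha : 1 ≤ a) (hb : 1 ≤ b)
    (h : 3 * ((a + 1) * (b + 1)) + 2 * a ≤ a * b * ((a + 1) * (b + 1) - 1)) :
    3 / (a * b) + 5 / (a * b * ((a + 1) * (b + 1))) +
      8 / (a * b * ((a + 1) * (b + 1)) * ((a + 2) * (b + 2))) ≤ 1 := by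
  have hab : 1 ≤ a * b := one_le_mul_of_one_le_of_one_le ha hb
  obtain ⟨P, hP⟩ : ∃ P, P = (a + 1) * (b + 1) := ⟨_, rfl⟩
  obtain ⟨Q, hQ⟩ : ∃ Q, Q = (a + 2) * (b + 2) := ⟨_, rfl⟩
  have hP4 : 4 ≤ P := by nlinarith
  have hQ9 : 9 ≤ Q := by nlinarith
  rw [← hP] at h ⊢
  rw [← hQ]
  have key : 5 * Q + 8 ≤ (a * b - 3) * (P * Q) := by
    -- For `ab ≤ 5` the hypothesis reads `(ab - 3)(P - 1) ≥ 2a + 3 ≥ 5`, and `key` is checked after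
    -- multiplying by `P - 1`. For `ab ≥ 5` the factor `ab - 3 ≥ 2` is enough by itself.
    rcases le_total (a * b) 5 with h5 | h5
    · have h1 : 5 ≤ (a * b - 3) * (P - 1) := by nlinarith
      have h2 : 8 * (P - 1) ≤ 5 * Q := by nlinarith
      have h3 : 5 * (P * Q) ≤ (a * b - 3) * (P - 1) * (P * Q) :=
        mul_le_mul_of_nonneg_right h1 (by positivity)
      refine le_of_mul_le_mul_right ?_ (show 0 < P - 1 by linarith)
      nlinarith
    · have h1 : 2 * (P * Q) ≤ (a * b - 3) * (P * Q) :=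
        mul_le_mul_of_nonneg_right (by linarith) (by positivity)
      nlinarith
  have hab0 : 0 < a * b := by linarith
  have e : 3 / (a * b) + 5 / (a * b * P) + 8 / (a * b * P * Q) =
      (3 * (P * Q) + 5 * Q + 8) / (a * b * P * Q) := by
    have : P ≠ 0 := by linarith
    have : Q ≠ 0 := by linarith
    field_simp
  rw [e, div_le_one (by positivity)]
  linarith

/-- A sequence whose ratios from index `3` on are at most `1 / 8`. -/
theorem summable_and_tsum_le_of_ratio {t : ℕ → ℝ} (ht : ∀ k, 0 ≤ t k)
    (hr : ∀ k, t (k + 4) ≤ t (k + 3) / 8) :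
    Summable t ∧ ∑' k, t k ≤ t 0 + t 1 + t 2 + 8 / 7 * t 3 := by
  have hgeo : ∀ k, t (k + 3) ≤ t 3 * (1 / 8) ^ k := by
    intro k
    induction k with
    | zero => simp
    | succ k ih =>
      rw [pow_succ]
      have := hr k
      rw [show k + 1 + 3 = k + 4 by ring]
      linarith
  have hsg : HasSum (fun k : ℕ => t 3 * (1 / 8 : ℝ) ^ k) (t 3 * (1 - 1 / 8)⁻¹) :=
    (hasSum_geometric_of_lt_one (by norm_num) (by norm_num)).mul_left _
  have hs3 : Summable fun k => t (k + 3) :=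
    Summable.of_nonneg_of_le (fun k => ht _) hgeo hsg.summable
  have hs : Summable t := (summable_nat_add_iff 3).1 hs3
  refine ⟨hs, ?_⟩
  rw [← hs.sum_add_tsum_nat_add 3]
  have h := hs3.tsum_le_tsum hgeo hsg.summable
  rw [hsg.tsum_eq] at h
  simp only [Finset.sum_range_succ, Finset.sum_range_zero]
  norm_num at h ⊢
  linarith

theorem Gamma_add_natCast_le {a μ : ℝ} (ha : 1 ≤ a) (hμ : 1 ≤ μ) (k : ℕ) :
    Real.Gamma (a + k) ≤ Real.Gamma (a + k * μ) := by
  rcases k.eq_zero_or_pos with rfl | hk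
  -- `Γ` need not increase on `[1, 2]`; `k = 0` is an equality, and `k ≥ 1` puts both arguments in
  -- `[2, ∞)`.
  · simp
  · have hk1 : (1 : ℝ) ≤ k := by exact_mod_cast hk
    refine Real.Gamma_strictMonoOn_Ici.monotoneOn ?_ ?_ ?_
    · rw [Set.mem_Ici]; linarith
    · rw [Set.mem_Ici]; nlinarith
    · nlinarith

theorem mainTheorem8 (μ a ν b : ℝ) (ha : 1 ≤ a) (hb : 1 ≤ b) (hμ : 1 ≤ μ) (hν : 1 ≤ ν)
    (hτ : tauBound a ≤ b) : normWright μ a ν b ∈ classSp := by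
  have hG : ∀ x : ℝ, 1 ≤ x → ∀ k : ℕ, 0 < Real.Gamma (x + k) := fun x hx k =>
    Real.Gamma_pos_of_pos (by positivity)
  have hGa : 0 < Real.Gamma a := Real.Gamma_pos_of_pos (by linarith)
  have hGb : 0 < Real.Gamma b := Real.Gamma_pos_of_pos (by linarith)
  set c : ℕ → ℝ := fun k =>
    Real.Gamma a * Real.Gamma b / (Real.Gamma (a + k * μ) * Real.Gamma (b + k * ν)) with hcdef
  set d : ℕ → ℝ := fun k =>
    Real.Gamma a * Real.Gamma b / (Real.Gamma (a + k) * Real.Gamma (b + k)) with hddef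
  have hd : ∀ k, 0 < d k := fun k =>
    div_pos (mul_pos hGa hGb) (mul_pos (hG a ha k) (hG b hb k))
  have hcpos : ∀ k, 0 ≤ c k := fun k =>
    div_nonneg (mul_pos hGa hGb).le (mul_nonneg
      ((hG a ha k).le.trans (Gamma_add_natCast_le ha hμ k))
      ((hG b hb k).le.trans (Gamma_add_natCast_le hb hν k)))
  have hcd : ∀ k, c k ≤ d k := fun k =>
    div_le_div_of_nonneg_left (mul_pos hGa hGb).le (mul_pos (hG a ha k) (hG b hb k))
      (mul_le_mul (Gamma_add_natCast_le ha hμ k) (Gamma_add_natCast_le hb hν k)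
        (hG b hb k).le ((hG a ha k).le.trans (Gamma_add_natCast_le ha hμ k)))
  have hd0 : d 0 = 1 := by
    simp only [hddef, Nat.cast_zero, add_zero]
    exact div_self (mul_pos hGa hGb).ne'
  have hdsucc : ∀ k : ℕ, d (k + 1) = d k / ((a + k) * (b + k)) := by
    intro k
    have hak : a + k ≠ 0 := by positivity
    have hbk : b + k ≠ 0 := by positivity
    simp only [hddef, Nat.cast_succ, ← add_assoc]
    rw [Real.Gamma_add_one hak, Real.Gamma_add_one hbk, div_div]
    congr 1
    ring
  have hd1 : d 1 = 1 / (a * b) := by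
    rw [hdsucc 0, hd0]; simp
  have hd2 : d 2 = 1 / (a * b * ((a + 1) * (b + 1))) := by
    rw [hdsucc 1, hd1, div_div]; simp
  have hd3 : d 3 = 1 / (a * b * ((a + 1) * (b + 1)) * ((a + 2) * (b + 2))) := by
    rw [hdsucc 2, hd2, div_div]; simp
  obtain ⟨hsd, hled⟩ := summable_and_tsum_le_of_ratio
    (t := fun k : ℕ => (2 * (k : ℝ) + 1) * d k)
    (fun k => mul_nonneg (by positivity) (hd k).le) (by
      intro k
      have hk : (0 : ℝ) ≤ k := Nat.cast_nonneg k
      -- The ratio of weights `(2k + 9)/(2k + 7)` is at most `2`, so `1/16` becomes `1/8`.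
      have hprod : (16 : ℝ) ≤ (a + (k + 3 : ℕ)) * (b + (k + 3 : ℕ)) := by
        push_cast
        nlinarith
      have hdk := hd (k + 3)
      have hstep : d (k + 4) ≤ d (k + 3) / 16 := by
        rw [hdsucc (k + 3)]
        exact div_le_div_of_nonneg_left hdk.le (by norm_num) hprod
      have h1 := mul_le_mul_of_nonneg_left hstep
        (show (0 : ℝ) ≤ 2 * ((k + 4 : ℕ) : ℝ) + 1 by positivity)
      refine h1.trans ?_
      push_cast
      nlinarith [mul_nonneg hk hdk.le])
  have hterm : ∀ k : ℕ, (2 * (k : ℝ) + 1) * c k ≤ (2 * (k : ℝ) + 1) * d k := fun k =>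
    mul_le_mul_of_nonneg_left (hcd k) (by positivity)
  have hsc : Summable fun k : ℕ => (2 * (k : ℝ) + 1) * c k :=
    Summable.of_nonneg_of_le (fun k => mul_nonneg (by positivity) (hcpos k)) hterm hsd
  have hfin := three_terms_le_one ha hb (quadratic_nonneg_of_tauBound_le ha hτ)
  have hle : ∑' k : ℕ, (2 * (k : ℝ) + 1) * c k ≤ 2 := by
    refine (hsc.tsum_le_tsum hterm hsd).trans (hled.trans ?_)
    rw [hd0, hd1, hd2, hd3]
    -- The tail factor `8/7` meets the weight `2 * 3 + 1 = 7` of `d 3`, giving the `8` in `hfin`.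
    refine le_of_eq_of_le ?_ ((add_le_add_right hfin 1).trans one_add_one_eq_two.le)
    push_cast
    ring
  have hc0 : c 0 = 1 := by
    simp only [hcdef, Nat.cast_zero, zero_mul, add_zero]
    exact div_self (mul_pos hGa hGb).ne'
  have hW : normWright μ a ν b = fun z : ℂ => z * ∑' k : ℕ, (c k : ℂ) * z ^ k := by
    funext z
    rw [normWright, fourParamWright, mul_assoc, mul_assoc, ← tsum_mul_left, ← tsum_mul_left]
    congr 1
    refine tsum_congr fun k => ?_
    simp only [hcdef]
    push_cast
    ring
  rw [hW]
  exact mul_tsum_mem_classSp hcpos hc0 hsc hle
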